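/- For nonnegative integers $\lambda, n, k, t, d$ and a prime power $q$, consider an $n \times k$ array whose entries are nonzero vectors of $\mathbb{F}_q^d$. Say that it has strength $t$ and index $\lambda$ if for every set $T$ of $t$ columns there are at least $\lambda$ rows whose entries in the columns of $T$ (taken as a family indexed by $T$) are linearly independent over $\mathbb{F}_q$. A covering perfect hash family CPHF$(n; k, q, t)$ is such an array with $d = t$ that has strength $t$ and index $1$. Let $q$ be an odd prime power. Then there exists a CPHF$(3; \frac{q^2+1}{2}, q, 4)$, that is, a $3 \times \frac{q^2+1}{2}$ array of nonzero vectors of $\mathbb{F}_q^4$ such that for every four columns some row has linearly independent entries in these columns, each of whose rows, regarded as a $1 \times \frac{q^2+1}{2}$ array of vectors of $\mathbb{F}_q^4$, has strength $3$ and index $1$: in each row, the entries in any three distinct columns are linearly independent over $\mathbb{F}_q$. -/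

import Mathlib

/-- `A` is an `n × k` array of nonzero vectors of `F ^ d` such that for every set `T` of `t` columns
there are at least `lam` rows whose entries in the columns of `T` are linearly independent.
(The entries are taken as a family indexed by `T`, so equal entries in two columns of `T` count as
dependent.) -/
def IsCoveringHashFamily {F : Type*} [Field F] {n k d : ℕ} (lam t : ℕ)
    (A : Fin n → Fin k → (Fin d → F)) : Prop :=
  (∀ r c, A r c ≠ 0) ∧
    ∀ T : Finset (Fin k), T.card = t →
      lam ≤ {r : Fin n | LinearIndependent F (fun c : T => A r c)}.ncard

/-- A covering perfect hash family `CPHF_lam(n; k, q, t)` over the field `F` with `q` elements: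
the entries are nonzero vectors of `F ^ t`, and the strength is the dimension `t`. -/
def IsCPHF {F : Type*} [Field F] {n k t : ℕ} (lam : ℕ)
    (A : Fin n → Fin k → (Fin t → F)) : Prop :=
  IsCoveringHashFamily lam t A

section CrossRatio

variable {K : Type*} [Field K]

/-- The cross-ratio of four elements of a field. -/
def crossRatio (a b c d : K) : K := (a - c) * (b - d) / ((b - c) * (a - d))

theorem crossRatio_mem_fixed_of_relation (φ : K →+* K) {X d : Fin 4 → K}
    (hX : Function.Injective X) (hd : d ≠ 0) (h1 : ∑ i, d i = 0) (hx : ∑ i, d i * X i = 0)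
    (hy : ∑ i, d i * φ (X i) = 0) (hxy : ∑ i, d i * (X i * φ (X i)) = 0) :
    crossRatio (X 0) (X 1) (X 2) (X 3) ∈ φ.eqLocusField (RingHom.id K) := by
  have ne : ∀ i j : Fin 4, i ≠ j → X i - X j ≠ 0 := fun i j h => sub_ne_zero.2 (hX.ne h)
  have neφ : ∀ i j : Fin 4, i ≠ j → φ (X i) - φ (X j) ≠ 0 := fun i j h =>
    sub_ne_zero.2 (φ.injective.ne (hX.ne h))
  rw [Fin.sum_univ_four] at h1 hx hy hxy
  have e1 : d 2 * ((X 2 - X 0) * (φ (X 2) - φ (X 1))) +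
      d 3 * ((X 3 - X 0) * (φ (X 3) - φ (X 1))) = 0 := by
    linear_combination hxy - X 0 * hy - φ (X 1) * hx + X 0 * φ (X 1) * h1
  have e2 : d 2 * ((X 2 - X 1) * (φ (X 2) - φ (X 0))) +
      d 3 * ((X 3 - X 1) * (φ (X 3) - φ (X 0))) = 0 := by
    linear_combination hxy - X 1 * hy - φ (X 0) * hx + X 1 * φ (X 0) * h1
  have key : (X 0 - X 2) * (X 1 - X 3) * ((φ (X 1) - φ (X 2)) * (φ (X 0) - φ (X 3))) =
      (φ (X 0) - φ (X 2)) * (φ (X 1) - φ (X 3)) * ((X 1 - X 2) * (X 0 - X 3)) := by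
    by_cases h3 : d 3 = 0
    · have h2 : d 2 = 0 := by
        simpa [h3, ne 2 0 (by decide), neφ 2 1 (by decide)] using e1
      have h0 : d 0 = 0 := by
        have : d 0 * (X 0 - X 1) = 0 := by
          linear_combination hx - X 1 * h1 - (X 2 - X 1) * h2 - (X 3 - X 1) * h3
        exact (mul_eq_zero.1 this).resolve_right (ne 0 1 (by decide))
      have h1' : d 1 = 0 := by simpa [h0, h2, h3] using h1
      exact absurd (funext fun i => by fin_cases i <;> assumption) hd
    · refine sub_eq_zero.1 ((mul_eq_zero.1 ?_).resolve_left h3)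
      linear_combination ((X 2 - X 0) * (φ (X 2) - φ (X 1))) * e2
        - ((X 2 - X 1) * (φ (X 2) - φ (X 0))) * e1
  rw [RingHom.mem_eqLocusField, RingHom.id_apply, crossRatio]
  simp only [map_div₀, map_mul, map_sub]
  rw [div_eq_div_iff (mul_ne_zero (neφ 1 2 (by decide)) (neφ 0 3 (by decide)))
    (mul_ne_zero (ne 1 2 (by decide)) (ne 0 3 (by decide)))]
  exact key.symm

theorem eq_zero_of_relation_three (φ : K →+* K) {X d : Fin 3 → K}
    (hX : Function.Injective X) (h1 : ∑ i, d i = 0) (hx : ∑ i, d i * X i = 0)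
    (hy : ∑ i, d i * φ (X i) = 0) (hxy : ∑ i, d i * (X i * φ (X i)) = 0) : d = 0 := by
  have ne : ∀ i j : Fin 3, i ≠ j → X i - X j ≠ 0 := fun i j h => sub_ne_zero.2 (hX.ne h)
  have neφ : ∀ i j : Fin 3, i ≠ j → φ (X i) - φ (X j) ≠ 0 := fun i j h =>
    sub_ne_zero.2 (φ.injective.ne (hX.ne h))
  rw [Fin.sum_univ_three] at h1 hx hy hxy
  have h2 : d 2 = 0 := by
    have : d 2 * ((X 2 - X 0) * (φ (X 2) - φ (X 1))) = 0 := by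
      linear_combination hxy - X 0 * hy - φ (X 1) * hx + X 0 * φ (X 1) * h1
    simpa [ne 2 0 (by decide), neφ 2 1 (by decide)] using this
  have h0 : d 0 = 0 := by
    have : d 0 * (X 0 - X 1) = 0 := by
      linear_combination hx - X 1 * h1 - (X 2 - X 1) * h2
    exact (mul_eq_zero.1 this).resolve_right (ne 0 1 (by decide))
  have h1' : d 1 = 0 := by simpa [h0, h2] using h1
  exact funext fun i => by fin_cases i <;> assumption

/-- If the cross-ratios of `a, b, c, d`, of their squares and of their fourth powers all lie in a
subfield, so do the normalised squares of `a * b + c * d` and `a * c + b * d`. -/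
theorem sq_div_mem_of_crossRatio_mem (S : Subfield K) (two : (2 : K) ≠ 0) {a b c d : K}
    (ha : a ≠ 0) (hb : b ≠ 0) (hc : c ≠ 0) (hd : d ≠ 0)
    (hab : a ^ 4 ≠ b ^ 4) (hac : a ^ 4 ≠ c ^ 4) (had : a ^ 4 ≠ d ^ 4)
    (hbc : b ^ 4 ≠ c ^ 4) (hbd : b ^ 4 ≠ d ^ 4) (hcd : c ^ 4 ≠ d ^ 4)
    (h1 : crossRatio a b c d ∈ S) (h2 : crossRatio (a ^ 2) (b ^ 2) (c ^ 2) (d ^ 2) ∈ S)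
    (h4 : crossRatio (a ^ 4) (b ^ 4) (c ^ 4) (d ^ 4) ∈ S) :
    (a * b + c * d) ^ 2 / (a * b * c * d) ∈ S ∧ (a * c + b * d) ^ 2 / (a * b * c * d) ∈ S := by
  have split : ∀ x y : K, x ^ 4 ≠ y ^ 4 → x - y ≠ 0 ∧ x + y ≠ 0 ∧ x ^ 2 + y ^ 2 ≠ 0 := by
    intro x y h
    rw [← sub_ne_zero, show x ^ 4 - y ^ 4 = (x - y) * ((x + y) * (x ^ 2 + y ^ 2)) by ring] at h
    simpa only [mul_ne_zero_iff] using h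
  obtain ⟨mab, pab, sab⟩ := split a b hab
  obtain ⟨mac, pac, sac⟩ := split a c hac
  obtain ⟨mad, pad, sad⟩ := split a d had
  obtain ⟨mbc, pbc, sbc⟩ := split b c hbc
  obtain ⟨mbd, pbd, sbd⟩ := split b d hbd
  obtain ⟨mcd, pcd, scd⟩ := split c d hcd
  have hk : (a + c) * (b + d) / ((a + d) * (b + c)) ∈ S := by
    convert div_mem h2 h1 using 1
    have e : ∀ x y : K, x ^ 2 - y ^ 2 = (x - y) * (x + y) := fun x y => by ring
    rw [crossRatio, crossRatio, e, e, e, e]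
    field_simp
  have hl : (a ^ 2 + c ^ 2) * (b ^ 2 + d ^ 2) / ((a ^ 2 + d ^ 2) * (b ^ 2 + c ^ 2)) ∈ S := by
    convert div_mem h4 h2 using 1
    have e : ∀ x y : K, x ^ 4 - y ^ 4 = (x ^ 2 - y ^ 2) * (x ^ 2 + y ^ 2) := fun x y => by ring
    have ne : ∀ x y : K, x - y ≠ 0 → x + y ≠ 0 → x ^ 2 - y ^ 2 ≠ 0 := fun x y h h' => by
      rw [sq_sub_sq]; exact mul_ne_zero h' h
    have n1 := ne a c mac pac
    have n2 := ne b d mbd pbd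
    have n3 := ne b c mbc pbc
    have n4 := ne a d mad pad
    rw [crossRatio, crossRatio, e, e, e, e]
    field_simp
  have hC : (a + d) * (b + c) ≠ 0 := mul_ne_zero pad pbc
  have hC' : (a ^ 2 + d ^ 2) * (b ^ 2 + c ^ 2) ≠ 0 := mul_ne_zero sad sbc
  have hA : (a + b) * (c + d) / ((a + d) * (b + c)) ∈ S := by
    have hne : 1 - crossRatio a b c d ≠ 0 := by
      rw [crossRatio, show 1 - (a - c) * (b - d) / ((b - c) * (a - d)) =
        (a - b) * (d - c) / ((b - c) * (a - d)) by field_simp; ring]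
      have : d - c ≠ 0 := by rwa [← neg_sub, neg_ne_zero]
      simp [*]
    convert div_mem (sub_mem (one_mem S) (mul_mem h1 hk)) (sub_mem (one_mem S) h1) using 1
    rw [eq_div_iff hne, crossRatio]
    field_simp
    ring
  have hC2 : (a ^ 2 + d ^ 2) * (b ^ 2 + c ^ 2) / ((a + d) * (b + c)) ^ 2 ∈ S := by
    have hne : (a ^ 2 + c ^ 2) * (b ^ 2 + d ^ 2) / ((a ^ 2 + d ^ 2) * (b ^ 2 + c ^ 2)) - 1 ≠ 0 := by
      rw [show (a ^ 2 + c ^ 2) * (b ^ 2 + d ^ 2) / ((a ^ 2 + d ^ 2) * (b ^ 2 + c ^ 2)) - 1 =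
        -((a - b) * (a + b) * ((c - d) * (c + d))) / ((a ^ 2 + d ^ 2) * (b ^ 2 + c ^ 2)) by
          field_simp; ring]
      exact div_ne_zero (neg_ne_zero.2 (by simp [*])) hC'
    convert div_mem (mul_mem hA (sub_mem hk (one_mem S))) (sub_mem hl (one_mem S)) using 1
    rw [eq_div_iff hne]
    field_simp
    ring
  have hT : ∀ A B : K, A ∈ S → B ∈ S → (B + 1 - A) / 2 ∈ S := fun A B hA hB =>
    div_mem (sub_mem (add_mem hB (one_mem S)) hA) (ofNat_mem S 2)
  have hθ : (a * b + c * d) / ((a + d) * (b + c)) ∈ S := by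
    convert hT _ _ hA hk using 1
    field_simp
    ring
  have hη : (a * c + b * d) / ((a + d) * (b + c)) ∈ S := by
    convert hT _ _ hk hA using 1
    field_simp
    ring
  have hP : a * b * c * d / ((a + d) * (b + c)) ^ 2 ∈ S := by
    have four : (4 : K) ≠ 0 := by
      rw [show (4 : K) = 2 * 2 by norm_num]; exact mul_ne_zero two two
    convert div_mem (sub_mem (add_mem (pow_mem hθ 2) (pow_mem hη 2)) hC2) (ofNat_mem S 4) using 1
    rw [eq_div_iff four]
    field_simp
    ring
  constructor
  · convert div_mem (pow_mem hθ 2) hP using 1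
    field_simp
  · convert div_mem (pow_mem hη 2) hP using 1
    field_simp

theorem eq_one_of_add_inv_mem_fixed (φ : K →+* K) {v : K} (hv : v ≠ 0) {N : ℕ} (hN : Odd N)
    (hvN : v ^ N = 1) (hφ : φ (φ v) = v⁻¹) (h : v + v⁻¹ ∈ φ.eqLocusField (RingHom.id K)) :
    v = 1 := by
  rw [RingHom.mem_eqLocusField, RingHom.id_apply, map_add, map_inv₀] at h
  have hφv : φ v ≠ 0 := (map_ne_zero φ).2 hv
  have hprod : (φ v - v) * (φ v - v⁻¹) = 0 := by
    have h' : φ v * φ v + 1 = (v + v⁻¹) * φ v := by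
      rw [← h]; field_simp
    linear_combination h' + mul_inv_cancel₀ hv
  have hvv : φ (φ v) = v := by
    rcases mul_eq_zero.1 hprod with h | h
    · rw [sub_eq_zero.1 h, sub_eq_zero.1 h]
    · rw [sub_eq_zero.1 h, map_inv₀, sub_eq_zero.1 h, inv_inv]
  have hv2 : v ^ 2 = 1 := by
    rw [hvv] at hφ
    rw [pow_two]
    nth_rewrite 2 [hφ]
    exact mul_inv_cancel₀ hv
  obtain ⟨m, rfl⟩ := hN
  simpa [pow_add, pow_mul, hv2] using hvN

end CrossRatio

section Ovoid

variable {F K : Type*} [Field F] [Field K] [Algebra F K]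

theorem exists_relation_of_not_linearIndependent (φ : K →ₐ[F] K) {ι : Type*} [Fintype ι]
    {z : ι → K} (hz : ∀ i, z i ≠ 0) (hφ : ∀ i, φ (φ (z i)) = (z i)⁻¹)
    (h : ¬ LinearIndependent F fun i => z i * φ (z i)) :
    ∃ d : ι → K, d ≠ 0 ∧ ∑ i, d i = 0 ∧ ∑ i, d i * z i ^ 2 = 0 ∧
      ∑ i, d i * φ (z i ^ 2) = 0 ∧ ∑ i, d i * (z i ^ 2 * φ (z i ^ 2)) = 0 := by
  obtain ⟨c, h0, i, hi⟩ := Fintype.not_linearIndependent_iff.1 h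
  have hφz : ∀ i, φ (z i) ≠ 0 := fun i => (map_ne_zero φ).2 (hz i)
  have h1 := congrArg φ h0
  have h2 := congrArg φ h1
  have h3 := congrArg φ h2
  simp only [map_sum, map_smul, map_mul, map_zero, hφ, map_inv₀, inv_inv] at h1 h2 h3
  refine ⟨fun i => c i • ((z i)⁻¹ * (φ (z i))⁻¹), fun hd => ?_, ?_, ?_, ?_, ?_⟩
  · have := congrFun hd i
    simp [hi, hz i, hφz i] at this
  · exact h2
  · rw [← h3]
    refine Finset.sum_congr rfl fun i _ => ?_
    have := hz i
    have := hφz i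
    simp only [Algebra.smul_def]
    field_simp
  · rw [← h1]
    refine Finset.sum_congr rfl fun i _ => ?_
    have := hz i
    have := hφz i
    simp only [Algebra.smul_def, map_pow]
    field_simp
  · rw [← h0]
    refine Finset.sum_congr rfl fun i _ => ?_
    have := hz i
    have := hφz i
    simp only [Algebra.smul_def, map_pow]
    field_simp

theorem linearIndependent_three (φ : K →ₐ[F] K) {z : Fin 3 → K} (hz : ∀ i, z i ≠ 0)
    (hφ : ∀ i, φ (φ (z i)) = (z i)⁻¹) (hinj : Function.Injective fun i => z i ^ 2) :
    LinearIndependent F fun i => z i * φ (z i) := by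
  by_contra h
  obtain ⟨d, hd, h1, hx, hy, hxy⟩ := exists_relation_of_not_linearIndependent φ hz hφ h
  exact hd (eq_zero_of_relation_three (φ : K →+* K) hinj h1 hx hy hxy)

theorem crossRatio_mem_fixed_of_not_linearIndependent (φ : K →ₐ[F] K) {z : Fin 4 → K}
    (hz : ∀ i, z i ≠ 0) (hφ : ∀ i, φ (φ (z i)) = (z i)⁻¹)
    (hinj : Function.Injective fun i => z i ^ 2)
    (h : ¬ LinearIndependent F fun i => z i * φ (z i)) :
    crossRatio (z 0 ^ 2) (z 1 ^ 2) (z 2 ^ 2) (z 3 ^ 2) ∈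
      (φ : K →+* K).eqLocusField (RingHom.id K) := by
  obtain ⟨d, hd, h1, hx, hy, hxy⟩ := exists_relation_of_not_linearIndependent φ hz hφ h
  exact crossRatio_mem_fixed_of_relation (φ : K →+* K) hinj hd h1 hx hy hxy

theorem pow_two_pow_injOn {N : ℕ} (hN : Odd N) (r : ℕ) {x y : K} (hx : x ^ N = 1)
    (hy : y ^ N = 1) (h : x ^ 2 ^ r = y ^ 2 ^ r) : x = y := by
  have hN0 : N ≠ 0 := hN.pos.ne'
  have hy0 : y ≠ 0 := by rintro rfl; simp [hN0] at hy
  have h1 : (x / y) ^ N = 1 := by rw [div_pow, hx, hy, div_one]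
  have h2 : (x / y) ^ 2 ^ r = 1 := by rw [div_pow, h, div_self (pow_ne_zero _ hy0)]
  have hco : Nat.Coprime N (2 ^ r) := (Nat.coprime_two_right.2 hN).pow_right r
  have h3 : x / y = 1 := by
    rw [← orderOf_eq_one_iff, ← Nat.dvd_one, ← hco]
    exact Nat.dvd_gcd (orderOf_dvd_of_pow_eq_one h1) (orderOf_dvd_of_pow_eq_one h2)
  exact (div_eq_one_iff_eq hy0).1 h3

/-- Four distinct elements of odd order on which the square of `φ` is inversion are independent
in at least one of the three embeddings `z ↦ w * φ w`, `w = z, z ^ 2, z ^ 4`. -/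
theorem exists_linearIndependent_four (φ : K →ₐ[F] K) (two : (2 : K) ≠ 0) {N : ℕ} (hN : Odd N)
    (hφ : ∀ x : K, x ^ N = 1 → φ (φ x) = x⁻¹) {z : Fin 4 → K} (hz : ∀ i, z i ^ N = 1)
    (hinj : Function.Injective z) :
    ∃ r : Fin 3, LinearIndependent F fun i => z i ^ 2 ^ (r : ℕ) * φ (z i ^ 2 ^ (r : ℕ)) := by
  by_contra! hdep
  have hz0 : ∀ i, z i ≠ 0 := fun i h => by
    have := hz i
    simp [h, hN.pos.ne'] at this
  have hpN : ∀ i m, (z i ^ m) ^ N = 1 := fun i m => by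
    rw [← pow_mul, mul_comm, pow_mul, hz, one_pow]
  have hne : ∀ r i j, i ≠ j → z i ^ 2 ^ r ≠ z j ^ 2 ^ r := fun r i j hij h =>
    hij (hinj (pow_two_pow_injOn hN r (hz i) (hz j) h))
  have hsq : ∀ r : ℕ, ∀ i, (z i ^ 2 ^ r) ^ 2 = z i ^ 2 ^ (r + 1) := fun r i => by
    rw [← pow_mul, pow_succ]
  have hcr : ∀ r : Fin 3, crossRatio (z 0 ^ 2 ^ (r + 1 : ℕ)) (z 1 ^ 2 ^ (r + 1 : ℕ))
      (z 2 ^ 2 ^ (r + 1 : ℕ)) (z 3 ^ 2 ^ (r + 1 : ℕ)) ∈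
        (φ : K →+* K).eqLocusField (RingHom.id K) := by
    intro r
    have := crossRatio_mem_fixed_of_not_linearIndependent φ
      (fun i => pow_ne_zero (2 ^ (r : ℕ)) (hz0 i)) (fun i => hφ _ (hpN i _))
      (fun i j hij => by
        by_contra h
        simp only [hsq] at hij
        exact hne _ i j h hij) (hdep r)
    simpa only [hsq] using this
  have hn4 : ∀ i j, i ≠ j → (z i ^ 2) ^ 4 ≠ (z j ^ 2) ^ 4 := fun i j hij => by
    simpa [← pow_mul] using hne 3 i j hij
  have hp : ∀ i, z i ^ 2 ≠ 0 := fun i => pow_ne_zero 2 (hz0 i)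
  obtain ⟨m1, m2⟩ := sq_div_mem_of_crossRatio_mem ((φ : K →+* K).eqLocusField (RingHom.id K)) two
    (hp 0) (hp 1) (hp 2) (hp 3)
    (hn4 0 1 (by decide)) (hn4 0 2 (by decide)) (hn4 0 3 (by decide)) (hn4 1 2 (by decide))
    (hn4 1 3 (by decide)) (hn4 2 3 (by decide))
    (by simpa using hcr 0) (by simpa [← pow_mul] using hcr 1) (by simpa [← pow_mul] using hcr 2)
  have hone : ∀ a b c d : K, a ≠ 0 → b ≠ 0 → c ≠ 0 → d ≠ 0 → a ^ N = 1 → b ^ N = 1 →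
      c ^ N = 1 → d ^ N = 1 →
      (a * b + c * d) ^ 2 / (a * b * c * d) ∈ (φ : K →+* K).eqLocusField (RingHom.id K) →
      a * b = c * d := by
    intro a b c d ha hb hc hd ha' hb' hc' hd' hm
    have hv : (a * b / (c * d)) ^ N = 1 := by simp [div_pow, mul_pow, *]
    refine (div_eq_one_iff_eq (mul_ne_zero hc hd)).1 (eq_one_of_add_inv_mem_fixed (φ : K →+* K)
      (div_ne_zero (mul_ne_zero ha hb) (mul_ne_zero hc hd)) hN hv (hφ _ hv) ?_)
    convert sub_mem hm (ofNat_mem _ 2) using 1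
    field_simp
    ring
  have e1 := hone _ _ _ _ (hp 0) (hp 1) (hp 2) (hp 3) (hpN 0 2) (hpN 1 2) (hpN 2 2) (hpN 3 2) m1
  have e2 := hone _ _ _ _ (hp 0) (hp 2) (hp 1) (hp 3) (hpN 0 2) (hpN 2 2) (hpN 1 2) (hpN 3 2)
    (by convert m2 using 2; ring)
  refine hne 2 1 2 (by decide) (mul_left_cancel₀ (mul_ne_zero (hp 0) (hp 3)) ?_)
  linear_combination z 1 ^ 2 * z 3 ^ 2 * e1 - z 2 ^ 2 * z 3 ^ 2 * e2

end Ovoid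

theorem FiniteField.exists_extension_of_degree (F : Type*) [Field F] [Finite F] (n : ℕ)
    [NeZero n] : ∃ (K : Type) (_ : Field K) (_ : Finite K) (_ : Algebra F K),
      Module.finrank F K = n := by
  obtain ⟨p, hp⟩ := CharP.exists F
  have : Fact p.Prime := ⟨CharP.char_is_prime F p⟩
  exact ⟨FiniteField.Extension F p n, inferInstance, inferInstance, inferInstance,
    FiniteField.finrank_extension F p n⟩

theorem exists_orderOf_eq_of_dvd_card_units {K : Type*} [Field K] [Finite K] {N : ℕ}
    (h : N ∣ Nat.card Kˣ) : ∃ g : Kˣ, orderOf g = N := by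
  obtain ⟨u, hu⟩ := IsCyclic.exists_ofOrder_eq_natCard (α := Kˣ)
  have : N ≠ 0 := fun h0 => Nat.card_pos.ne' (Nat.eq_zero_of_zero_dvd (h0 ▸ h))
  exact ⟨u ^ (Nat.card Kˣ / N), by
    rw [← hu] at h ⊢
    exact orderOf_pow_orderOf_div (by rw [hu]; exact Nat.card_pos.ne') h⟩

theorem LinearIndependent.finset_of_fin {F V ι : Type*} [Field F] [AddCommGroup V] [Module F V]
    {t : ℕ} (T : Finset ι) (hT : T.card = t) {v : ι → V}
    (h : LinearIndependent F fun i : Fin t => v ((T.equivFinOfCardEq hT).symm i)) :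
    LinearIndependent F fun c : T => v c :=
  (linearIndependent_equiv (T.equivFinOfCardEq hT).symm).1 h

theorem corollary5 (q : ℕ) (hq : IsPrimePow q) (hodd : Odd q)
    (F : Type*) [Field F] [Fintype F] (hF : Fintype.card F = q) :
    ∃ C : Fin 3 → Fin ((q ^ 2 + 1) / 2) → (Fin 4 → F),
      IsCPHF 1 C ∧
        ∀ r : Fin 3, IsCoveringHashFamily 1 3 (fun _ : Fin 1 => C r) := by
  obtain ⟨K, _, _, _, hK⟩ := FiniteField.exists_extension_of_degree F 4
  obtain ⟨s, hs⟩ := hodd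
  have hN : 2 * ((q ^ 2 + 1) / 2) = q ^ 2 + 1 := by
    have : q ^ 2 + 1 = 2 * (2 * s ^ 2 + 2 * s + 1) := by rw [hs]; ring
    omega
  have hNodd : Odd ((q ^ 2 + 1) / 2) := by
    have : q ^ 2 + 1 = 2 * (2 * (s ^ 2 + s) + 1) := by rw [hs]; ring
    exact ⟨s ^ 2 + s, by omega⟩
  generalize (q ^ 2 + 1) / 2 = N at hN hNodd ⊢
  have hcard : Nat.card K = q ^ 4 := by
    rw [Module.natCard_eq_pow_finrank (K := F), hK, Nat.card_eq_fintype_card, hF]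
  have hdvd : N ∣ Nat.card Kˣ := by
    rw [Nat.card_units, hcard, show q ^ 4 - 1 = (q ^ 2 + 1) * (q ^ 2 - 1) by
      rw [← Nat.sq_sub_sq, ← pow_mul, one_pow], ← hN]
    exact Dvd.intro_left (2) rfl |>.mul_right _
  obtain ⟨g, hg⟩ := exists_orderOf_eq_of_dvd_card_units hdvd
  have two : (2 : K) ≠ 0 := by
    have h2 : (2 : F) ≠ 0 := by
      refine Ring.two_ne_zero fun h => ?_
      have := FiniteField.even_card_iff_char_two.1 h
      omega
    rw [← map_ofNat (algebraMap F K) 2]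
    exact (map_ne_zero _).2 h2
  obtain ⟨φ, hφ⟩ : ∃ φ : K →ₐ[F] K, ∀ x : K, x ^ N = 1 → φ (φ x) = x⁻¹ := by
    refine ⟨FiniteField.frobeniusAlgHom F K, fun x hx => ?_⟩
    simp only [FiniteField.frobeniusAlgHom_apply, hF]
    refine eq_inv_of_mul_eq_one_left ?_
    rw [← pow_mul, ← pow_two, ← pow_succ, ← hN, mul_comm, pow_mul, hx, one_pow]
  let z : Fin N → K := fun j => ((g ^ (j : ℕ) : Kˣ) : K)
  have hzN : ∀ j, z j ^ N = 1 := fun j => by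
    have : g ^ N = 1 := hg ▸ pow_orderOf_eq_one g
    rw [← Units.val_pow_eq_pow_val, ← pow_mul, mul_comm, pow_mul, this, one_pow, Units.val_one]
  have hz0 : ∀ j, z j ≠ 0 := fun j => Units.ne_zero _
  have hzinj : Function.Injective z := fun i j h =>
    Fin.ext (pow_injOn_Iio_orderOf (by simp [hg]) (by simp [hg]) (Units.ext h))
  let e : K ≃ₗ[F] (Fin 4 → F) := (Module.finBasisOfFinrankEq F K hK).equivFun
  have he : ∀ {ι : Type} {v : ι → K}, LinearIndependent F v →
      LinearIndependent F fun i => e (v i) := fun h => h.map' e.toLinearMap e.ker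
  have hpos : ∀ {n : ℕ} (s : Set (Fin n)) (r : Fin n), r ∈ s → 1 ≤ s.ncard := fun s r hr =>
    (Set.ncard_pos s.toFinite).2 ⟨r, hr⟩
  have hne : ∀ r j, e (z j ^ 2 ^ r * φ (z j ^ 2 ^ r)) ≠ 0 := fun r j => by
    rw [map_ne_zero_iff e e.injective]
    exact mul_ne_zero (pow_ne_zero _ (hz0 j)) ((map_ne_zero φ).2 (pow_ne_zero _ (hz0 j)))
  refine ⟨fun r j => e (z j ^ 2 ^ (r : ℕ) * φ (z j ^ 2 ^ (r : ℕ))), ⟨fun r j => hne r j, ?_⟩,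
    fun r => ⟨fun _ j => hne r j, ?_⟩⟩
  · intro T hT
    obtain ⟨r, hr⟩ := exists_linearIndependent_four φ two hNodd hφ
      (z := fun i => z ((T.equivFinOfCardEq hT).symm i)) (fun i => hzN _)
      (hzinj.comp (Subtype.val_injective.comp (Equiv.injective _)))
    refine hpos _ r ?_
    rw [Set.mem_ofPred_eq]
    exact LinearIndependent.finset_of_fin T hT
      (v := fun j => e (z j ^ 2 ^ (r : ℕ) * φ (z j ^ 2 ^ (r : ℕ)))) (he hr)
  · intro T hT
    refine hpos _ 0 ?_
    rw [Set.mem_ofPred_eq]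
    refine LinearIndependent.finset_of_fin T hT
      (v := fun j => e (z j ^ 2 ^ (r : ℕ) * φ (z j ^ 2 ^ (r : ℕ)))) (he ?_)
    refine linearIndependent_three φ
      (z := fun i => z ((T.equivFinOfCardEq hT).symm i) ^ 2 ^ (r : ℕ))
      (fun i => pow_ne_zero _ (hz0 _)) (fun i => hφ _ ?_) ?_
    · rw [← pow_mul, mul_comm, pow_mul, hzN, one_pow]
    · intro i j hij
      simp only [← pow_mul, ← pow_succ] at hij
      exact (Equiv.injective _) (Subtype.val_injective
        (hzinj (pow_two_pow_injOn hNodd _ (hzN _) (hzN _) hij)))
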